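/- Let $n\ge 2$ and $m_i\ge 2$ for $i\in\{1,\dots,n\}$; put $\mathcal M=\prod_{i}\{1,\dots,m_i\}$ and $q=q_{n,\mathbf m}:=\big(\prod_{i=1}^n m_i\big)/\max_i m_i$. Draw all payoffs $U_i(\mathbf a)$ ($1\le i\le n$, $\mathbf a\in\mathcal M$) independently from an atomless probability distribution $\mathbb P$ on $\mathbb R$, and draw an initial profile $\mathbf A^0$ uniformly from $\mathcal M$, independently of the payoffs. In the clockwork best-response dynamic, at each time $t=1,2,\dots$ the player $i=1+((t-1)\bmod n)$ replaces her action by her (almost surely unique) best response to the current actions of the other players, all other actions being kept. Let $p_{n,\mathbf m}$ be the probability that the resulting path hits a pure Nash equilibrium of the game at some finite time $t\geq 1$. Then, up to a polynomial factor in $n$ and a factor $\sqrt{\log q}$, $p_{n,\mathbf m}$ is of order $1/\sqrt{q}$; precisely: (a) for all $n\ge 2$, all $m_1,\dots,m_n\ge 2$ and all atomless $\mathbb P$, $$\frac{1}{4\sqrt n}\cdot\frac1{\sqrt{q_{n,\mathbf m}}}\;\le\; p_{n,\mathbf m}\;\le\; 6n\sqrt{\log q_{n,\mathbf m}}\cdot\frac{1}{\sqrt{q_{n,\mathbf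 m}}};$$ (b) consequently $p_{n,\mathbf m}=q_{n,\mathbf m}^{-1/2+o(1)}$ as $q_{n,\mathbf m}\to\infty$, uniformly: for every $\varepsilon>0$ there is $Q$ such that $q_{n,\mathbf m}^{-1/2-\varepsilon}\le p_{n,\mathbf m}\le q_{n,\mathbf m}^{-1/2+\varepsilon}$ for all $n\ge2$, all $m_1,\dots,m_n\ge 2$ with $q_{n,\mathbf m}\ge Q$, and all atomless $\mathbb P$. -/

import Mathlib

open MeasureTheory

namespace ClockworkBR

/-- Action profiles of a game with `n` players in which player `i` has `m i` actions. -/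
abbrev Profile {n : ℕ} (m : Fin n → ℕ) : Type := (i : Fin n) → Fin (m i)

/-- The payoff functions `u i : Profile m → ℝ` of all players. -/
abbrev Payoffs {n : ℕ} (m : Fin n → ℕ) : Type := Fin n → Profile m → ℝ

/-- The set of player `i`'s best responses to the environment formed by the coordinates of `a`
other than `i` (the value `a i` plays no role). -/
noncomputable def bestResponses {n : ℕ} {m : Fin n → ℕ} (u : Payoffs m) (i : Fin n)
    (a : Profile m) : Finset (Fin (m i)) :=
  Finset.univ.filter fun x => ∀ y : Fin (m i), u i (Function.update a i y) ≤ u i (Function.update a i x)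

theorem bestResponses_nonempty {n : ℕ} {m : Fin n → ℕ} (u : Payoffs m) (i : Fin n)
    (a : Profile m) : (bestResponses u i a).Nonempty := by
  have : Nonempty (Fin (m i)) := ⟨a i⟩
  obtain ⟨x, hx⟩ := Finite.exists_max fun y : Fin (m i) => u i (Function.update a i y)
  exact ⟨x, by simpa [bestResponses] using hx⟩

/-- The best response of player `i`. It is the unique one whenever there are no ties; for
definiteness a tie, which has probability zero for the random games below, is broken in favour
of the smallest action. -/
noncomputable def bestResponse {n : ℕ} {m : Fin n → ℕ} (u : Payoffs m) (i : Fin n)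
    (a : Profile m) : Fin (m i) :=
  (bestResponses u i a).min' (bestResponses_nonempty u i a)

/-- The set of pure Nash equilibria. -/
def PNE {n : ℕ} {m : Fin n → ℕ} (u : Payoffs m) : Set (Profile m) :=
  {a | ∀ (i : Fin n) (x : Fin (m i)), u i (Function.update a i x) ≤ u i a}

/-- The clockwork playing sequence: at the times `t = 1, 2, 3, …` the players with (zero-based)
indices `0, 1, …, n - 1, 0, 1, …` play. The value at `t = 0` is never used. -/
def clockwork (n : ℕ) [NeZero n] (t : ℕ) : Fin n := Fin.ofNat n (t - 1)

/-- The path of the best-response dynamic with playing sequence `s`, started at `a₀`: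
at time `t + 1` player `s (t + 1)` best-responds to the environment at time `t`. -/
noncomputable def brPath {n : ℕ} {m : Fin n → ℕ} (u : Payoffs m) (s : ℕ → Fin n)
    (a₀ : Profile m) : ℕ → Profile m
  | 0 => a₀
  | t + 1 => Function.update (brPath u s a₀ t) (s (t + 1))
      (bestResponse u (s (t + 1)) (brPath u s a₀ t))

/-- The dynamic converges to a pure Nash equilibrium: its path hits one at a finite time
`t ≥ 1`. -/
def ConvergesToPNE {n : ℕ} {m : Fin n → ℕ} (u : Payoffs m) (s : ℕ → Fin n)
    (a₀ : Profile m) : Prop :=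
  ∃ t : ℕ, 1 ≤ t ∧ brPath u s a₀ t ∈ PNE u

/-- The joint law of the random game, all of whose payoffs are independent with law `P`, and of
the initial profile, which is uniform on all profiles and independent of the payoffs. -/
noncomputable def randomGame {n : ℕ} (m : Fin n → ℕ) (P : Measure ℝ) [IsProbabilityMeasure P] :
    Measure (Payoffs m × Profile m) :=
  (Measure.pi fun _ : Fin n => Measure.pi fun _ : Profile m => P).prod
    (ProbabilityTheory.uniformOn (Set.univ : Set (Profile m)))

/-- The probability that the clockwork best-response dynamic on the random game converges to a
pure Nash equilibrium. -/
noncomputable def convergenceProb {n : ℕ} [NeZero n] (m : Fin n → ℕ) (P : Measure ℝ)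
    [IsProbabilityMeasure P] : ℝ :=
  (randomGame m P).real {ω | ConvergesToPNE ω.1 (clockwork n) ω.2}

/-- The minimal number of environments, `(∏ i, m i) / max i, m i`. -/
noncomputable def minEnv {n : ℕ} (m : Fin n → ℕ) : ℝ :=
  (∏ i, (m i : ℝ)) / ((Finset.univ.sup m : ℕ) : ℝ)

end ClockworkBR

/-! The argument compares the path with a sampling scheme. As long as no player meets an environment
twice (`fresh`), each move is uniform and independent of the past: exchanging two payoffs in an
unvisited row preserves the law and leaves the history unchanged (`measure_new_move`). In a round
every player moves once, so a fresh path lands in a given environment of player `j` with probability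
at most one over the number of environments of `j` (`measure_fresh_target_le`). Let `q` be the least
such number, attained by player `i`.

Upper bound. Once an environment recurs, the path is periodic. Without ties it can then converge
only if the first recurrence comes exactly one round after the earlier visit
(`exists_first_repetition_of_converges`). Thus either the path stays fresh for `k + 1` rounds, with
probability at most `exp (-k(k+1)/(2q))` as in the birthday problem, or such a one-round recurrence
occurs at one of `k n` times, each with probability at most `1/q`. The choice of `k` near `√(q log
q)` balances the two.

Lower bound. Starting just after a move of `i`, the other `n - 1` players all keep their actions
with conditional probability at least `1/q`, provided the past is in `spread`; the profile is then
an equilibrium (`mem_PNE_of_still`). These events are disjoint over rounds, and `spread` stays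
likely for about `√(q/n)` rounds, so their probabilities add up to order `1/√(nq)`. -/

namespace ClockworkBR

variable {n : ℕ} {m : Fin n → ℕ}

/-! ### Environments, best responses and ties. -/

/-- Two profiles present the same environment to player `i`. -/
def AgreeOff (i : Fin n) (a b : Profile m) : Prop := ∀ j, j ≠ i → a j = b j

theorem AgreeOff.refl (i : Fin n) (a : Profile m) : AgreeOff i a a := fun _ _ => rfl

theorem AgreeOff.symm {i : Fin n} {a b : Profile m} (h : AgreeOff i a b) : AgreeOff i b a :=
  fun j hj => (h j hj).symm

theorem AgreeOff.trans {i : Fin n} {a b c : Profile m} (h : AgreeOff i a b) (h' : AgreeOff i b c) :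
    AgreeOff i a c := fun j hj => (h j hj).trans (h' j hj)

theorem agreeOff_update (i : Fin n) (a : Profile m) (x : Fin (m i)) :
    AgreeOff i (Function.update a i x) a := fun j hj => by simp [hj]

theorem AgreeOff.update_eq {i : Fin n} {a b : Profile m} (h : AgreeOff i a b) (x : Fin (m i)) :
    Function.update a i x = Function.update b i x := by
  funext j
  by_cases hj : j = i
  · subst hj; simp
  · simp [hj, h j hj]

theorem AgreeOff.eq_of_apply_eq {i : Fin n} {a b : Profile m} (h : AgreeOff i a b)
    (hi : a i = b i) : a = b := by
  funext j
  by_cases hj : j = i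
  · subst hj; exact hi
  · exact h j hj

/-- Best responses are determined by the payoffs in the row of the environment. -/
theorem bestResponse_congr {u u' : Payoffs m} {i : Fin n} {a a' : Profile m}
    (h : ∀ x, u i (Function.update a i x) = u' i (Function.update a' i x)) :
    bestResponse u i a = bestResponse u' i a' := by
  have : bestResponses u i a = bestResponses u' i a' := by
    simp only [bestResponses, h]
  simp only [bestResponse, this]

theorem AgreeOff.bestResponse_eq {i : Fin n} {a b : Profile m} (h : AgreeOff i a b)
    (u : Payoffs m) : bestResponse u i a = bestResponse u i b :=
  bestResponse_congr fun x => by rw [h.update_eq]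

theorem le_bestResponse (u : Payoffs m) (i : Fin n) (a : Profile m) (y : Fin (m i)) :
    u i (Function.update a i y) ≤ u i (Function.update a i (bestResponse u i a)) := by
  have := Finset.min'_mem _ (bestResponses_nonempty u i a)
  simp only [bestResponses, Finset.mem_filter] at this
  exact this.2 y

/-- No player is indifferent between two of her actions in any environment. -/
def NoTies (u : Payoffs m) : Prop :=
  ∀ (i : Fin n) (a : Profile m) (x y : Fin (m i)),
    u i (Function.update a i x) = u i (Function.update a i y) → x = y

theorem NoTies.bestResponse_eq {u : Payoffs m} (hu : NoTies u) {i : Fin n} {a : Profile m}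
    {x : Fin (m i)} (hx : ∀ y, u i (Function.update a i y) ≤ u i (Function.update a i x)) :
    bestResponse u i a = x :=
  hu i a _ _ (le_antisymm (hx _) (le_bestResponse u i a x))

theorem mem_PNE_of_forall_bestResponse_eq {u : Payoffs m} {a : Profile m}
    (h : ∀ i, bestResponse u i a = a i) : a ∈ PNE u := fun i x => by
  have := le_bestResponse u i a x
  rwa [h i, Function.update_eq_self] at this

theorem NoTies.bestResponse_eq_of_mem_PNE {u : Payoffs m} (hu : NoTies u) {a : Profile m}
    (ha : a ∈ PNE u) (i : Fin n) : bestResponse u i a = a i :=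
  hu.bestResponse_eq fun y => by simpa using ha i y

/-! ### Exchanging two payoffs in a row. -/

/-- Exchange the payoffs of player `i` at the actions `v` and `w` in the environment of `e`. -/
def rowSwap (i : Fin n) (e : Profile m) (v w : Fin (m i)) (u : Payoffs m) : Payoffs m :=
  fun k => if k = i then
    fun a => u k (Equiv.swap (Function.update e i v) (Function.update e i w) a) else u k

theorem swap_update (i : Fin n) (e : Profile m) (v w y : Fin (m i)) :
    Equiv.swap (Function.update e i v) (Function.update e i w) (Function.update e i y) =
      Function.update e i (Equiv.swap v w y) := by
  rcases eq_or_ne y v with rfl | hv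
  · simp
  rcases eq_or_ne y w with rfl | hw
  · simp
  rw [Equiv.swap_apply_of_ne_of_ne hv hw, Equiv.swap_apply_of_ne_of_ne]
  · exact fun h => hv (Function.update_injective e i h)
  · exact fun h => hw (Function.update_injective e i h)

/-- The maximum of the row moves with the exchange. Excluding ties for `u` makes `w` the only
maximiser. -/
theorem bestResponse_of_bestResponse_rowSwap {i : Fin n} {e : Profile m} {v w : Fin (m i)}
    {u : Payoffs m} (hu : NoTies u) (h : bestResponse (rowSwap i e v w u) i e = v) :
    bestResponse u i e = w := by
  refine hu.bestResponse_eq fun y => ?_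
  have := le_bestResponse (rowSwap i e v w u) i e (Equiv.swap v w y)
  rw [h] at this
  simpa [rowSwap, swap_update] using this

theorem bestResponse_rowSwap_of_ne {i k : Fin n} {e a : Profile m} (v w : Fin (m i))
    (u : Payoffs m) (h : k = i → ¬ AgreeOff i a e) :
    bestResponse (rowSwap i e v w u) k a = bestResponse u k a := by
  refine bestResponse_congr fun x => ?_
  by_cases hk : k = i
  · subst hk
    have key : ∀ z, Function.update a k x ≠ Function.update e k z := fun z hz =>
      h rfl fun j hj => by simpa [hj] using congrFun hz j
    simp only [rowSwap, if_true]
    rw [Equiv.swap_apply_of_ne_of_ne (key _) (key _)]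
  · simp [rowSwap, hk]

/-! ### Invariance of the payoff law, and absence of ties. -/

/-- The law of the payoffs. -/
noncomputable abbrev payoffLaw (m : Fin n → ℕ) (P : Measure ℝ) : Measure (Payoffs m) :=
  Measure.pi fun _ : Fin n => Measure.pi fun _ : Profile m => P

section Law

variable (P : Measure ℝ) [IsProbabilityMeasure P]

/-- `rowSwap` permutes coordinates of a product of identical measures. -/
theorem measurePreserving_rowSwap (i : Fin n) (e : Profile m) (v w : Fin (m i)) :
    MeasurePreserving (rowSwap i e v w) (payoffLaw m P) (payoffLaw m P) := by
  have key := measurePreserving_pi (ι := Fin n) (fun _ => Measure.pi fun _ : Profile m => P)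
    (fun _ => Measure.pi fun _ : Profile m => P)
    (f := fun k => if k = i then
      fun f a => f (Equiv.swap (Function.update e i v) (Function.update e i w) a) else id) ?_
  · convert key using 2
    rename_i u
    funext k
    by_cases hk : k = i <;> simp [rowSwap, hk]
  · intro k
    by_cases hk : k = i
    · simp only [hk, if_true]
      have := measurePreserving_arrowCongr' (fun _ : Profile m => P) (fun _ : Profile m => P)
        (Equiv.swap (Function.update e i v) (Function.update e i w)) (MeasurableEquiv.refl ℝ)
        (fun _ => MeasurePreserving.id P)
      convert this using 2
      funext a
      simp [MeasurableEquiv.arrowCongr', Equiv.arrowCongr', Equiv.arrowCongr]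
    · simp only [hk, if_false]
      exact MeasurePreserving.id _

/-- Two coordinates are independent, and by Fubini the diagonal is null for the square of an
atomless law. -/
theorem measure_pi_eq_apply [NullSingletonClass P] {ι : Type*} [Fintype ι] {a b : ι}
    (hab : a ≠ b) : (Measure.pi fun _ : ι => P) {f | f a = f b} = 0 := by
  have hind : ProbabilityTheory.IndepFun (fun f : ι → ℝ => f a) (fun f => f b)
      (Measure.pi fun _ : ι => P) :=
    (ProbabilityTheory.iIndepFun_pi (μ := fun _ : ι => P) (X := fun _ => id)
      fun _ => aemeasurable_id).indepFun hab
  rw [ProbabilityTheory.indepFun_iff_map_prod_eq_prod_map_map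
    (measurable_pi_apply a).aemeasurable (measurable_pi_apply b).aemeasurable] at hind
  have ha := (measurePreserving_eval (fun _ : ι => P) a).map_eq
  have hb := (measurePreserving_eval (fun _ : ι => P) b).map_eq
  change Measure.map (fun f : ι → ℝ => f a) _ = P at ha
  change Measure.map (fun f : ι → ℝ => f b) _ = P at hb
  have hd : MeasurableSet {p : ℝ × ℝ | p.1 = p.2} := measurableSet_eq_fun measurable_fst measurable_snd
  have h0 : (Measure.map (fun f : ι → ℝ => (f a, f b)) (Measure.pi fun _ : ι => P))
      {p : ℝ × ℝ | p.1 = p.2} = 0 := by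
    rw [hind, ha, hb, Measure.prod_apply hd]
    simp
  rwa [Measure.map_apply (by fun_prop) hd] at h0

theorem ae_noTies [NullSingletonClass P] : ∀ᵐ u ∂payoffLaw m P, NoTies u := by
  simp only [NoTies, ae_all_iff]
  intro i a x y
  by_cases hxy : x = y
  · simp [hxy]
  have hne : Function.update a i x ≠ Function.update a i y :=
    fun h => hxy (Function.update_injective a i h)
  have hm : MeasurableSet {f : Profile m → ℝ | f (Function.update a i x) = f (Function.update a i y)} :=
    measurableSet_eq_fun (measurable_pi_apply _) (measurable_pi_apply _)
  have h := (measurePreserving_eval (fun _ : Fin n => Measure.pi fun _ : Profile m => P)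
    i).measure_preimage hm.nullMeasurableSet
  rw [measure_pi_eq_apply P hne] at h
  rw [ae_iff]
  simpa [hxy] using h

end Law

theorem measurable_bestResponse (i : Fin n) (a : Profile m) :
    Measurable fun u : Payoffs m => bestResponse u i a := by
  have hmem : ∀ x, MeasurableSet {u : Payoffs m | x ∈ bestResponses u i a} := fun x => by
    simp only [bestResponses, Finset.mem_filter, Finset.mem_univ, true_and, Set.ofPred_forall]
    exact MeasurableSet.iInter fun y => measurableSet_le (by fun_prop) (by fun_prop)
  refine measurable_to_countable' fun x => ?_
  have : (fun u : Payoffs m => bestResponse u i a) ⁻¹' {x} =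
      {u | x ∈ bestResponses u i a} ∩ ⋂ y, ⋂ (_ : y < x), {u | y ∈ bestResponses u i a}ᶜ := by
    ext u
    simp only [Set.mem_preimage, Set.mem_singleton_iff, Set.mem_inter_iff, Set.mem_ofPred_eq,
      Set.mem_iInter, Set.mem_compl_iff, bestResponse]
    constructor
    · rintro rfl
      exact ⟨Finset.min'_mem _ _, fun y hy hmem => absurd (Finset.min'_le _ _ hmem) (not_le.2 hy)⟩
    · rintro ⟨hx, hlt⟩
      refine le_antisymm (Finset.min'_le _ _ hx) (not_lt.1 fun h => hlt _ h (Finset.min'_mem _ _))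
  rw [this]
  exact (hmem x).inter (.iInter fun y => .iInter fun _ => (hmem y).compl)

/-! ### The clockwork path, its history and new environments. -/

section Dynamic

variable [NeZero n]

/-- The player who moves at time `t + 1`. -/
def mover (n : ℕ) [NeZero n] (t : ℕ) : Fin n := Fin.ofNat n t

theorem mover_eq_iff {s t : ℕ} : mover n s = mover n t ↔ s ≡ t [MOD n] := by
  simp [mover, Fin.ext_iff, Nat.ModEq]

theorem mover_add_self (t : ℕ) : mover n (t + n) = mover n t :=
  mover_eq_iff.2 (by simp [Nat.ModEq])

theorem mover_val (i : Fin n) : mover n i = i := by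
  simp [mover]

theorem mover_val_add_mul (i : Fin n) (k : ℕ) : mover n (i + k * n) = i := by
  rw [← mover_val i, mover_eq_iff, mover_val]
  simp [Nat.ModEq]

theorem injOn_mover_add (t : ℕ) :
    Set.InjOn (fun k => mover n (t + k)) (Finset.range n : Set ℕ) := by
  intro a ha b hb hab
  have := Nat.ModEq.add_left_cancel' t (mover_eq_iff.1 hab)
  simp only [Finset.coe_range, Set.mem_Iio] at ha hb
  exact this.eq_of_lt_of_lt ha hb

theorem image_mover_add (t : ℕ) :
    (Finset.range n).image (fun k => mover n (t + k)) = Finset.univ :=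
  Finset.eq_univ_of_card _ (by rw [Finset.card_image_of_injOn (injOn_mover_add t)]; simp)

theorem prod_mover {M : Type*} [CommMonoid M] (g : Fin n → M) (t : ℕ) :
    ∏ k ∈ Finset.range n, g (mover n (t + k)) = ∏ i, g i := by
  rw [← image_mover_add t, Finset.prod_image (injOn_mover_add t)]

/-- Every player moves in each window of length `n`. -/
theorem exists_mover_eq (t : ℕ) (j : Fin n) : ∃ k < n, mover n (t + k) = j := by
  have := Finset.mem_univ j
  rw [← image_mover_add t] at this
  simpa using this

/-- The path of the clockwork dynamic. -/
noncomputable def path (t : ℕ) (ω : Payoffs m × Profile m) : Profile m :=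
  brPath ω.1 (clockwork n) ω.2 t

theorem path_succ (t : ℕ) (ω : Payoffs m × Profile m) :
    path (t + 1) ω = Function.update (path t ω) (mover n t)
      (bestResponse ω.1 (mover n t) (path t ω)) := rfl

theorem path_succ_apply_mover (t : ℕ) (ω : Payoffs m × Profile m) :
    path (t + 1) ω (mover n t) = bestResponse ω.1 (mover n t) (path t ω) := by
  simp [path_succ]

theorem path_succ_apply_of_ne {t : ℕ} {j : Fin n} (h : j ≠ mover n t)
    (ω : Payoffs m × Profile m) : path (t + 1) ω j = path t ω j := by
  simp [path_succ, h]

theorem agreeOff_path_succ (t : ℕ) (ω : Payoffs m × Profile m) :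
    AgreeOff (mover n t) (path (t + 1) ω) (path t ω) :=
  fun _ hj => path_succ_apply_of_ne hj ω

theorem path_add_apply_of_forall_ne {t d : ℕ} {j : Fin n} (h : ∀ k < d, j ≠ mover n (t + k))
    (ω : Payoffs m × Profile m) : path (t + d) ω j = path t ω j := by
  induction d with
  | zero => rfl
  | succ d ih =>
    rw [← Nat.add_assoc, path_succ_apply_of_ne (h d (Nat.lt_succ_self d)),
      ih fun k hk => h k (hk.trans (Nat.lt_succ_self d))]

/-- After a repeated environment of the same player the path repeats. -/
theorem AgreeOff.path_succ_eq {s r : ℕ} {ω : Payoffs m × Profile m} (hm : mover n s = mover n r)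
    (h : AgreeOff (mover n r) (path s ω) (path r ω)) : path (s + 1) ω = path (r + 1) ω := by
  rw [path_succ, path_succ, hm, h.bestResponse_eq, h.update_eq]

theorem path_add_eq_of_eq {s r : ℕ} {ω : Payoffs m × Profile m} (hm : mover n s = mover n r)
    (h : path s ω = path r ω) (k : ℕ) : path (s + k) ω = path (r + k) ω := by
  induction k with
  | zero => exact h
  | succ k ih =>
    have : mover n (s + k) = mover n (r + k) :=
      mover_eq_iff.2 ((mover_eq_iff.1 hm).add_right k)
    exact AgreeOff.path_succ_eq this (ih ▸ AgreeOff.refl _ _)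

theorem measurable_path (t : ℕ) : Measurable (path (m := m) t) := by
  induction t with
  | zero => exact measurable_snd
  | succ t ih =>
    have h : Measurable fun p : Payoffs m × Profile m =>
        Function.update p.2 (mover n t) (bestResponse p.1 (mover n t) p.2) :=
      measurable_from_prod_countable_left fun a =>
        (measurable_of_countable fun x => Function.update a (mover n t) x).comp
          (measurable_bestResponse _ a)
    have e : path (m := m) (t + 1) = (fun p : Payoffs m × Profile m =>
        Function.update p.2 (mover n t) (bestResponse p.1 (mover n t) p.2)) ∘
        fun ω => (ω.1, path t ω) := funext fun ω => path_succ t ω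
    rw [e]
    exact h.comp (Measurable.prodMk measurable_fst ih)

/-- A set of outcomes that is determined by the path up to time `t`. -/
def IsPast (t : ℕ) (B : Set (Payoffs m × Profile m)) : Prop :=
  ∀ ω ω', (∀ k ≤ t, path k ω = path k ω') → ω ∈ B → ω' ∈ B

/-- There are only finitely many histories up to `t`, so `B` is the preimage of a finite set under a
measurable map. -/
theorem IsPast.measurableSet {t : ℕ} {B : Set (Payoffs m × Profile m)} (hB : IsPast t B) :
    MeasurableSet B := by
  let H : Payoffs m × Profile m → (Fin (t + 1) → Profile m) := fun ω k => path k ω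
  have hH : Measurable H := measurable_pi_lambda _ fun k => measurable_path k
  have : B = H ⁻¹' (H '' B) := by
    refine (Set.subset_preimage_image H B).antisymm ?_
    rintro ω ⟨ω', h, hω⟩
    exact hB ω' ω (fun k hk => congrFun hω ⟨k, Nat.lt_succ_of_le hk⟩) h
  rw [this]
  exact hH (Set.toFinite _).measurableSet

theorem IsPast.mono {s t : ℕ} (hst : s ≤ t) {B : Set (Payoffs m × Profile m)} (hB : IsPast s B) :
    IsPast t B := fun ω ω' h => hB ω ω' fun k hk => h k (hk.trans hst)

theorem IsPast.inter {t : ℕ} {B C : Set (Payoffs m × Profile m)} (hB : IsPast t B)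
    (hC : IsPast t C) : IsPast t (B ∩ C) :=
  fun ω ω' h hω => ⟨hB ω ω' h hω.1, hC ω ω' h hω.2⟩

theorem isPast_path_eq {s t : ℕ} (hst : s ≤ t) (e : Profile m) :
    IsPast t {ω : Payoffs m × Profile m | path s ω = e} := fun _ _ h hω => (h s hst).symm.trans hω

/-- The environment of the player moving at time `t + 1` is new to her. -/
def NewEnv (t : ℕ) (ω : Payoffs m × Profile m) : Prop :=
  ∀ s < t, mover n s = mover n t → ¬ AgreeOff (mover n t) (path s ω) (path t ω)

/-- No player has met an environment twice in the moves up to time `t`. -/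
def fresh (m : Fin n → ℕ) (t : ℕ) : Set (Payoffs m × Profile m) := {ω | ∀ r < t, NewEnv r ω}

theorem isPast_newEnv (t : ℕ) : IsPast t {ω : Payoffs m × Profile m | NewEnv t ω} := by
  intro ω ω' h hω s hs
  rw [← h s hs.le, ← h t le_rfl]
  exact hω s hs

theorem isPast_fresh_succ (t : ℕ) : IsPast t (fresh m (t + 1)) := by
  intro ω ω' h hω r hr
  exact isPast_newEnv r ω ω' (fun k hk => h k (hk.trans (Nat.le_of_lt_succ hr))) (hω r hr)

theorem fresh_anti {s t : ℕ} (h : s ≤ t) : fresh m t ⊆ fresh m s :=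
  fun _ hω r hr => hω r (hr.trans_le h)

theorem isPast_fresh (t : ℕ) : IsPast t (fresh m t) := by
  intro ω ω' h hω r hr
  exact isPast_newEnv r ω ω' (fun k hk => h k (hk.trans hr.le)) (hω r hr)

theorem fresh_succ (t : ℕ) : fresh m (t + 1) = fresh m t ∩ {ω | NewEnv t ω} := by
  ext ω
  simp only [fresh, Set.mem_ofPred_eq, Set.mem_inter_iff]
  exact ⟨fun h => ⟨fun r hr => h r (hr.trans (Nat.lt_succ_self t)), h t (Nat.lt_succ_self t)⟩,
    fun h r hr => (Nat.lt_succ_iff_lt_or_eq.1 hr).elim (h.1 r) fun e => e ▸ h.2⟩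

/-- The path up to `t` ignores the row of an environment that is new at time `t`. -/
theorem path_rowSwap {t : ℕ} {u : Payoffs m} {a e : Profile m} (v w : Fin (m (mover n t)))
    (hnew : NewEnv t (rowSwap (mover n t) e v w u, a))
    (he : path t (rowSwap (mover n t) e v w u, a) = e) {k : ℕ} (hk : k ≤ t) :
    path k (rowSwap (mover n t) e v w u, a) = path k (u, a) := by
  induction k with
  | zero => rfl
  | succ k ih =>
    have ih := ih (Nat.le_of_succ_le hk)
    rw [path_succ, path_succ, ← ih]
    congr 1
    refine bestResponse_rowSwap_of_ne v w u fun hm => ?_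
    have := hnew k hk hm
    rwa [he] at this

end Dynamic

end ClockworkBR

/-! ### Moves in new environments are uniform. -/

namespace ClockworkBR

theorem measureReal_eq_sum_fiber {Ω α : Type*} [MeasurableSpace Ω] [MeasurableSpace α] [Fintype α]
    [MeasurableSingletonClass α] (μ : Measure Ω) [IsFiniteMeasure μ] {A : Set Ω}
    (hA : MeasurableSet A) {f : Ω → α} (hf : Measurable f) :
    μ.real A = ∑ a, μ.real (A ∩ {ω | f ω = a}) := by
  rw [← measureReal_biUnion_finset]
  · congr 1
    ext ω
    simp
  · intro a _ b _ hab
    refine Set.disjoint_left.2 fun ω h h' => hab ?_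
    exact h.2.symm.trans h'.2
  · exact fun a _ => hA.inter (hf (measurableSet_singleton a))

variable {n : ℕ} {m : Fin n → ℕ} [∀ i, NeZero (m i)] (P : Measure ℝ) [IsProbabilityMeasure P]

instance : IsProbabilityMeasure (randomGame m P) := by
  have : IsProbabilityMeasure (ProbabilityTheory.uniformOn (Set.univ : Set (Profile m))) :=
    ProbabilityTheory.isProbabilityMeasure_uniformOn Set.finite_univ Set.univ_nonempty
  unfold randomGame
  infer_instance

theorem ae_randomGame_noTies [NullSingletonClass P] : ∀ᵐ ω ∂randomGame m P, NoTies ω.1 := by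
  have : IsProbabilityMeasure (ProbabilityTheory.uniformOn (Set.univ : Set (Profile m))) :=
    ProbabilityTheory.isProbabilityMeasure_uniformOn Set.finite_univ Set.univ_nonempty
  exact Measure.quasiMeasurePreserving_fst.ae (ae_noTies P)

variable [NeZero n] [NullSingletonClass P]

/-- The move in a given new environment takes any two values equally often. -/
theorem measure_new_move_le {t : ℕ} {B : Set (Payoffs m × Profile m)} (hB : IsPast t B)
    (hnew : ∀ ω ∈ B, NewEnv t ω) (e : Profile m) (v w : Fin (m (mover n t))) :
    (randomGame m P).real (B ∩ {ω | path t ω = e} ∩ {ω | path (t + 1) ω (mover n t) = v}) ≤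
      (randomGame m P).real (B ∩ {ω | path t ω = e} ∩ {ω | path (t + 1) ω (mover n t) = w}) := by
  have : IsProbabilityMeasure (ProbabilityTheory.uniformOn (Set.univ : Set (Profile m))) :=
    ProbabilityTheory.isProbabilityMeasure_uniformOn Set.finite_univ Set.univ_nonempty
  have hS : MeasurePreserving (Prod.map (rowSwap (mover n t) e v w) id)
      (randomGame m P) (randomGame m P) :=
    (measurePreserving_rowSwap P (mover n t) e v w).prod (MeasurePreserving.id _)
  have hmeas : MeasurableSet
      (B ∩ {ω | path t ω = e} ∩ {ω | path (t + 1) ω (mover n t) = v}) :=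
    (hB.measurableSet.inter (measurable_path t (measurableSet_singleton e))).inter
      ((measurable_pi_apply (mover n t)).comp (measurable_path (t + 1))
        (measurableSet_singleton v))
  rw [← hS.measureReal_preimage hmeas.nullMeasurableSet]
  -- Off the null set of ties, the exchange carries the event for `v` into the event for `w`.
  refine ENNReal.toReal_mono (measure_ne_top _ _) (measure_mono_ae ?_)
  filter_upwards [ae_randomGame_noTies P] with ω hω hmem
  obtain ⟨u, a⟩ := ω
  obtain ⟨⟨h1, h2⟩, h3⟩ := hmem
  have hpath : ∀ k ≤ t, path k (rowSwap (mover n t) e v w u, a) = path k (u, a) :=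
    fun k hk => path_rowSwap v w (hnew _ h1) h2 hk
  have h2' : path t (u, a) = e := (hpath t le_rfl).symm.trans h2
  refine ⟨⟨hB _ _ hpath h1, h2'⟩, ?_⟩
  have h2 : path t (rowSwap (mover n t) e v w u, a) = e := h2
  have h3 : path (t + 1) (rowSwap (mover n t) e v w u, a) (mover n t) = v := h3
  change path (t + 1) (u, a) (mover n t) = w
  rw [path_succ_apply_mover, h2] at h3
  rw [path_succ_apply_mover, h2']
  exact bestResponse_of_bestResponse_rowSwap hω h3

/-- In a new environment the move is uniform, independently of the past. -/
theorem measure_new_move {t : ℕ} {B : Set (Payoffs m × Profile m)} (hB : IsPast t B)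
    (hnew : ∀ ω ∈ B, NewEnv t ω) (v : Profile m → Fin (m (mover n t))) :
    (randomGame m P).real (B ∩ {ω | path (t + 1) ω (mover n t) = v (path t ω)}) =
      (randomGame m P).real B / m (mover n t) := by
  have hcard : (m (mover n t) : ℝ) ≠ 0 := Nat.cast_ne_zero.2 (NeZero.ne _)
  have hmove : Measurable fun ω : Payoffs m × Profile m => path (t + 1) ω (mover n t) :=
    (measurable_pi_apply (mover n t)).comp (measurable_path (t + 1))
  have hfib : ∀ e, MeasurableSet (B ∩ {ω | path t ω = e}) := fun e =>
    hB.measurableSet.inter (measurable_path t (measurableSet_singleton e))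
  have key : ∀ e (x : Fin (m (mover n t))),
      (randomGame m P).real (B ∩ {ω | path t ω = e} ∩ {ω | path (t + 1) ω (mover n t) = x}) =
        (randomGame m P).real (B ∩ {ω | path t ω = e}) / m (mover n t) := by
    intro e x
    -- All fibres over the possible moves have equal measure, so each is the average.
    rw [eq_div_iff hcard, measureReal_eq_sum_fiber _ (hfib e) hmove,
      Finset.sum_congr rfl fun y _ => le_antisymm (measure_new_move_le P hB hnew e y x)
        (measure_new_move_le P hB hnew e x y)]
    simp [mul_comm]
  have hv : MeasurableSet {ω : Payoffs m × Profile m |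
      path (t + 1) ω (mover n t) = v (path t ω)} :=
    measurableSet_eq_fun hmove ((measurable_of_countable v).comp (measurable_path t))
  rw [measureReal_eq_sum_fiber _ (hB.measurableSet.inter hv) (measurable_path t),
    measureReal_eq_sum_fiber _ hB.measurableSet (measurable_path t), Finset.sum_div]
  refine Finset.sum_congr rfl fun e _ => ?_
  rw [← key e (v e)]
  congr 1
  ext ω
  simp only [Set.mem_inter_iff, Set.mem_ofPred_eq]
  constructor
  · rintro ⟨⟨h1, h2⟩, rfl⟩
    exact ⟨⟨h1, rfl⟩, h2⟩
  · rintro ⟨⟨h1, rfl⟩, h2⟩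
    exact ⟨⟨h1, h2⟩, rfl⟩

/-- During a window of `n` fresh moves all players other than `j` reach prescribed actions with
at most the probability of independent uniform choices. -/
theorem measure_fresh_target_le {t : ℕ} {B : Set (Payoffs m × Profile m)} (hB : IsPast t B)
    (j : Fin n) (e : Profile m) :
    (randomGame m P).real (B ∩ fresh m (t + n) ∩ {ω | AgreeOff j (path (t + n) ω) e}) ≤
      (randomGame m P).real B / ∏ k ∈ Finset.univ.erase j, (m k : ℝ) := by
  -- The move of `j` is unconstrained and costs no factor.
  let w : Fin n → ℝ := fun k => if k = j then 1 else m k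
  let D : ℕ → Set (Payoffs m × Profile m) := fun d => B ∩ fresh m (t + d) ∩
    {ω | ∀ k < d, mover n (t + k) ≠ j →
      path (t + k + 1) ω (mover n (t + k)) = e (mover n (t + k))}
  have hw : ∀ k, 0 < w k := fun k => by
    by_cases hk : k = j
    · simp [w, hk]
    · simpa [w, hk] using Nat.pos_of_ne_zero (NeZero.ne (m k))
  have hprod : ∏ k ∈ Finset.range n, w (mover n (t + k)) =
      ∏ k ∈ Finset.univ.erase j, (m k : ℝ) := by
    rw [prod_mover, ← Finset.mul_prod_erase _ _ (Finset.mem_univ j)]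
    simp only [w, if_true, one_mul]
    exact Finset.prod_congr rfl fun k hk => by simp [Finset.ne_of_mem_erase hk]
  have step : ∀ d, (randomGame m P).real (D d) ≤
      (randomGame m P).real B / ∏ k ∈ Finset.range d, w (mover n (t + k)) := by
    intro d
    induction d with
    | zero =>
      simp only [Finset.range_zero, Finset.prod_empty, div_one]
      exact measureReal_mono fun ω h => h.1.1
    | succ d ih =>
      by_cases hj : mover n (t + d) = j
      · rw [Finset.prod_range_succ]
        simp only [w, hj, if_true, mul_one]
        refine le_trans (measureReal_mono ?_) ih
        exact fun ω h => ⟨⟨h.1.1, fresh_anti (Nat.le_succ _) h.1.2⟩,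
          fun k hk => h.2 k (hk.trans (Nat.lt_succ_self d))⟩
      · have hpast : IsPast (t + d) (D d ∩ {ω | NewEnv (t + d) ω}) := by
          refine ((((hB.mono (Nat.le_add_right _ _)).inter (isPast_fresh _)).inter ?_)).inter
            (isPast_newEnv _)
          intro ω ω' h hω k hk hkj
          rw [← h _ (by lia)]
          exact hω k hk hkj
        have h1 := measure_new_move P hpast (fun ω h => h.2) fun _ => e (mover n (t + d))
        have h2 : (randomGame m P).real (D (d + 1)) ≤ (randomGame m P).real (D d ∩
            {ω | NewEnv (t + d) ω} ∩ {ω | path (t + d + 1) ω (mover n (t + d)) =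
              e (mover n (t + d))}) := by
          refine measureReal_mono fun ω h => ⟨⟨⟨⟨h.1.1, fresh_anti (Nat.le_succ _) h.1.2⟩,
            fun k hk => h.2 k (hk.trans (Nat.lt_succ_self d))⟩, ?_⟩, ?_⟩
          · exact h.1.2 (t + d) (Nat.lt_succ_self _)
          · exact h.2 d (Nat.lt_succ_self d) hj
        have h3 : (randomGame m P).real (D d ∩ {ω | NewEnv (t + d) ω}) ≤
            (randomGame m P).real (D d) := measureReal_mono Set.inter_subset_left
        have hwd : w (mover n (t + d)) = m (mover n (t + d)) := by simp [w, hj]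
        rw [Finset.prod_range_succ, ← div_div]
        rw [h1, ← hwd] at h2
        exact h2.trans (div_le_div_of_nonneg_right (h3.trans ih) (hw _).le)
  rw [← hprod]
  refine le_trans (measureReal_mono ?_) (step n)
  rintro ω ⟨h1, h2⟩
  refine ⟨h1, fun k hk hkj => ?_⟩
  rw [← h2 _ hkj]
  -- A player does not move again within the window, so the action chosen at its only move is still
  -- in place at its end.
  have : t + n = t + k + 1 + (n - 1 - k) := by lia
  rw [this]
  refine (path_add_apply_of_forall_ne (fun l hl heq => ?_) ω).symm
  have := injOn_mover_add (n := n) t (by simpa using hk) (by simp; lia : k + 1 + l ∈ _)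
    (by simpa [Nat.add_assoc] using heq)
  lia

/-- A fresh path is back in a given old environment with at most the probability of independent
uniform choices. -/
theorem measure_fresh_agreeOff_le {s r : ℕ} (hsr : s + n ≤ r) (j : Fin n) :
    (randomGame m P).real (fresh m r ∩ {ω | AgreeOff j (path r ω) (path s ω)}) ≤
      1 / ∏ k ∈ Finset.univ.erase j, (m k : ℝ) := by
  obtain ⟨t, rfl⟩ := Nat.exists_eq_add_of_le (le_trans (Nat.le_add_left n s) hsr)
  rw [Nat.add_comm n t] at hsr ⊢
  have hst : s ≤ t := by lia
  have hA : MeasurableSet (fresh m (t + n) ∩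
      {ω | AgreeOff j (path (t + n) ω) (path s ω)}) := by
    refine ((isPast_fresh _).inter (t := t + n) ?_).measurableSet
    intro ω ω' h hω
    change AgreeOff _ _ _
    rw [← h _ le_rfl, ← h s (by lia)]
    exact hω
  -- Conditioning on the profile at time `s` turns the random target into a fixed one, settled
  -- before the last `n` moves begin.
  rw [measureReal_eq_sum_fiber _ hA (measurable_path s), ← probReal_univ (μ := randomGame m P),
    measureReal_eq_sum_fiber _ MeasurableSet.univ (measurable_path (m := m) s), Finset.sum_div]
  refine Finset.sum_le_sum fun e _ => ?_
  rw [Set.univ_inter]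
  refine le_trans (measureReal_mono ?_)
    (measure_fresh_target_le P (isPast_path_eq hst e) j e)
  rintro ω ⟨⟨h1, h2⟩, h3⟩
  exact ⟨⟨h3, h1⟩, by rw [← (show path s ω = e from h3)]; exact h2⟩

end ClockworkBR

/-! ### The upper bound: recurrences and the birthday estimate. -/

namespace ClockworkBR

variable {n : ℕ} {m : Fin n → ℕ}

/-- The number of environments of player `i`. -/
noncomputable def numEnv (m : Fin n → ℕ) (i : Fin n) : ℝ := ∏ k ∈ Finset.univ.erase i, (m k : ℝ)

theorem numEnv_pos [∀ i, NeZero (m i)] (i : Fin n) : 0 < numEnv m i :=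
  Finset.prod_pos fun _ _ => Nat.cast_pos.2 (Nat.pos_of_ne_zero (NeZero.ne _))

/-- Representatives of the environments of player `i`. -/
def envReps (m : Fin n → ℕ) [∀ i, NeZero (m i)] (i : Fin n) : Finset (Profile m) :=
  Fintype.piFinset fun k => if k = i then {0} else Finset.univ

theorem card_envReps [∀ i, NeZero (m i)] (i : Fin n) : ((envReps m i).card : ℝ) = numEnv m i := by
  rw [envReps, Fintype.card_piFinset, Nat.cast_prod,
    ← Finset.mul_prod_erase _ _ (Finset.mem_univ i), numEnv]
  simp only [if_true, Finset.card_singleton, Nat.cast_one, one_mul]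
  exact Finset.prod_congr rfl fun k hk => by simp [Finset.ne_of_mem_erase hk]

theorem update_mem_envReps [∀ i, NeZero (m i)] (i : Fin n) (a : Profile m) :
    Function.update a i 0 ∈ envReps m i := by
  rw [envReps, Fintype.mem_piFinset]
  intro k
  by_cases hk : k = i
  · subst hk; simp
  · simp [hk]

section Deterministic

variable [NeZero n]

theorem add_le_of_mover_eq {s r : ℕ} (hsr : s < r) (hm : mover n s = mover n r) : s + n ≤ r := by
  have h := (Nat.modEq_iff_dvd' hsr.le).1 (mover_eq_iff.1 hm)
  have := Nat.le_of_dvd (by lia) h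
  lia

theorem path_add_eq_of_mem_PNE {ω : Payoffs m × Profile m} (hω : NoTies ω.1) {T : ℕ}
    (hT : path T ω ∈ PNE ω.1) (k : ℕ) : path (T + k) ω = path T ω := by
  induction k with
  | zero => rfl
  | succ k ih =>
    rw [← Nat.add_assoc, path_succ, ih, hω.bestResponse_eq_of_mem_PNE hT, Function.update_eq_self]

/-- Without ties, a path that converges is fresh for ever, or the first repetition of an
environment occurs after exactly one round. -/
theorem exists_first_repetition_of_converges {ω : Payoffs m × Profile m} (hω : NoTies ω.1)
    (hc : ConvergesToPNE ω.1 (clockwork n) ω.2) (N : ℕ) :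
    ω ∈ fresh m N ∨ ∃ r, n ≤ r ∧ r < N ∧ ω ∈ fresh m r ∧
      AgreeOff (mover n r) (path r ω) (path (r - n) ω) := by
  classical
  refine or_iff_not_imp_left.2 fun hN => ?_
  have hex : ∃ r, r < N ∧ ¬ NewEnv r ω := by
    simpa [fresh] using hN
  obtain ⟨hrN, hr⟩ := Nat.find_spec hex
  set r := Nat.find hex
  have hfresh : ω ∈ fresh m r := fun k hk => by
    by_contra h
    exact Nat.find_min hex hk ⟨hk.trans hrN, h⟩
  obtain ⟨s, hs, hm, hag⟩ : ∃ s < r, mover n s = mover n r ∧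
      AgreeOff (mover n r) (path s ω) (path r ω) := by
    simpa [NewEnv] using hr
  obtain ⟨T, -, hT⟩ := hc
  have hle := add_le_of_mover_eq hs hm
  have hn := Nat.pos_of_ne_zero (NeZero.ne n)
  rcases hle.eq_or_lt with heq | hlt
  · refine ⟨r, by lia, hrN, hfresh, ?_⟩
    rw [show r - n = s by lia]
    exact hag.symm
  -- If the recurrence took longer than a round, the path would be periodic from `s + 1` on.
  -- Convergence would make it constant there, so the same environment would already recur at `s + n
  -- < r`.
  exfalso
  have hmod : s + 1 ≡ r + 1 [MOD n] := (mover_eq_iff.1 hm).add_right 1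
  have hper : ∀ k, path (s + 1 + k) ω = path (r + 1 + k) ω :=
    path_add_eq_of_eq (mover_eq_iff.2 hmod) (hag.path_succ_eq hm)
  have hperL : ∀ L k, path (s + 1 + k) ω = path (s + 1 + k + L * (r - s)) ω := by
    intro L
    induction L with
    | zero => simp
    | succ L ih =>
      intro k
      rw [ih, show s + 1 + k + L * (r - s) = s + 1 + (k + L * (r - s)) by ring, hper]
      congr 1
      have : (L + 1) * (r - s) = L * (r - s) + (r - s) := by ring
      lia
  have hconst : ∀ k, path (s + 1 + k) ω = path T ω := by
    intro k
    -- Adding `T` periods pushes the index beyond `T`, where the path is frozen at the equilibrium.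
    have hTle : T ≤ T * (r - s) := Nat.le_mul_of_pos_right _ (by lia)
    rw [hperL T k, show s + 1 + k + T * (r - s) = T + (s + 1 + k + T * (r - s) - T) by lia]
    exact path_add_eq_of_mem_PNE hω hT _
  refine hfresh (s + n) hlt s (by lia) (mover_add_self s).symm ?_
  rw [mover_add_self, show s + n = s + 1 + (n - 1) by lia, hconst]
  have := agreeOff_path_succ s ω
  rw [show path (s + 1) ω = path T ω from hconst 0] at this
  exact this.symm

theorem injOn_env_of_fresh [∀ i, NeZero (m i)] {i : Fin n} {k : ℕ} {ω : Payoffs m × Profile m}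
    (hω : ω ∈ fresh m (i + k * n + 1)) :
    Set.InjOn (fun l => Function.update (path (i + l * n) ω) i 0)
      (Finset.range (k + 1) : Set ℕ) := by
  have key : ∀ a b, a < b → b ≤ k → Function.update (path (i + a * n) ω) i 0 ≠
      Function.update (path (i + b * n) ω) i 0 := by
    intro a b hab hb heq
    have hbk : b * n ≤ k * n := Nat.mul_le_mul_right n hb
    have habn : a * n < b * n := Nat.mul_lt_mul_of_pos_right hab (Nat.pos_of_ne_zero (NeZero.ne n))
    refine hω (i + b * n) (by lia) (i + a * n) (by lia)
      ((mover_val_add_mul i a).trans (mover_val_add_mul i b).symm) ?_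
    rw [mover_val_add_mul]
    intro j hj
    simpa [hj] using congrFun heq j
  intro a ha b hb hab
  simp only [Finset.coe_range, Set.mem_Iio] at ha hb
  rcases lt_trichotomy a b with h | h | h
  · exact absurd hab (key a b h (by lia))
  · exact h
  · exact absurd hab.symm (key b a h (by lia))

end Deterministic

variable [∀ i, NeZero (m i)] (P : Measure ℝ) [IsProbabilityMeasure P]
variable [NeZero n] [NullSingletonClass P]

/-- By its move at time `i + k * n`, player `i` has met `k + 1` distinct environments on a fresh
path. One round later the path must reach one of the remaining ones, each hit with conditional
probability at most `1 / numEnv m i`. -/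
theorem measure_fresh_succ_le (i : Fin n) (k : ℕ) :
    (randomGame m P).real (fresh m (i + (k + 1) * n + 1)) ≤
      (1 - (k + 1) / numEnv m i) * (randomGame m P).real (fresh m (i + k * n + 1)) := by
  classical
  set t := (i : ℕ) + k * n with ht
  have hr : (i : ℕ) + (k + 1) * n = t + n := by rw [ht]; ring
  have hmt : mover n (t + n) = i := by rw [← hr, mover_val_add_mul]
  have hq := numEnv_pos (m := m) i
  rw [hr]
  let B : Profile m → Set (Payoffs m × Profile m) := fun e =>
    fresh m (t + 1) ∩ {ω | ∀ l ≤ k, ¬ AgreeOff i (path (i + l * n) ω) e}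
  have hlt : ∀ l ≤ k, (i : ℕ) + l * n ≤ t := fun l hl => by
    have := Nat.mul_le_mul_right n hl
    lia
  have hB : ∀ e, IsPast t (B e) := fun e => by
    refine (isPast_fresh_succ t).inter ?_
    intro ω ω' h hω l hl
    rw [← h _ (hlt l hl)]
    exact hω l hl
  have h1 : (randomGame m P).real (fresh m (t + n + 1)) ≤
      ∑ e ∈ envReps m i, (randomGame m P).real (B e) / numEnv m i := by
    calc (randomGame m P).real (fresh m (t + n + 1))
        ≤ (randomGame m P).real (⋃ e ∈ envReps m i,
          (B e ∩ fresh m (t + n) ∩ {ω | AgreeOff i (path (t + n) ω) e})) := by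
          refine measureReal_mono (fun ω hω => ?_) (measure_ne_top _ _)
          simp only [Set.mem_iUnion]
          have hag := (agreeOff_update i (path (t + n) ω) 0).symm
          refine ⟨_, update_mem_envReps i (path (t + n) ω), ⟨⟨?_, ?_⟩, ?_⟩, hag⟩
          · exact fresh_anti (by have := Nat.pos_of_ne_zero (NeZero.ne n); lia) hω
          · intro l hl hl'
            have := hlt l hl
            refine hω (t + n) (Nat.lt_succ_self _) (i + l * n)
              (by have := Nat.pos_of_ne_zero (NeZero.ne n); lia) ?_ ?_
            · rw [hmt, mover_val_add_mul]
            · rw [hmt]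
              exact hl'.trans hag.symm
          · exact fresh_anti (Nat.le_succ _) hω
      _ ≤ _ := measureReal_biUnion_finset_le _ _
      _ ≤ _ := Finset.sum_le_sum fun e _ => measure_fresh_target_le P (hB e) i e
  -- The sum is the expected number of unmet environments on the fresh event, computed by exchanging
  -- sum and integral.
  have h2 : ∑ e ∈ envReps m i, (randomGame m P).real (B e) ≤
      (numEnv m i - (k + 1)) * (randomGame m P).real (fresh m (t + 1)) := by
    have hint : ∀ e, Integrable ((B e).indicator (1 : Payoffs m × Profile m → ℝ))
        (randomGame m P) := fun e =>
      (integrable_const (1 : ℝ)).indicator (hB e).measurableSet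
    have hF := (isPast_fresh_succ (m := m) t).measurableSet
    calc ∑ e ∈ envReps m i, (randomGame m P).real (B e)
        = ∫ ω, ∑ e ∈ envReps m i, (B e).indicator (1 : Payoffs m × Profile m → ℝ) ω
            ∂randomGame m P := by
          rw [integral_finsetSum _ fun e _ => hint e]
          exact Finset.sum_congr rfl fun e _ => (integral_indicator_one (hB e).measurableSet).symm
      _ ≤ ∫ ω, (numEnv m i - (k + 1)) *
            (fresh m (t + 1)).indicator (1 : Payoffs m × Profile m → ℝ) ω ∂randomGame m P := by
          refine integral_mono (integrable_finsetSum _ fun e _ => hint e)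
            (((integrable_const (1 : ℝ)).indicator hF).const_mul _) fun ω => ?_
          by_cases hω : ω ∈ fresh m (t + 1)
          · have hcard := Finset.card_image_of_injOn (injOn_env_of_fresh (i := i) (k := k) hω)
            rw [Finset.card_range] at hcard
            set J := (Finset.range (k + 1)).image
              fun l => Function.update (path (i + l * n) ω) i 0 with hJ
            have hsub : J ⊆ envReps m i := by
              intro e he
              obtain ⟨l, -, rfl⟩ := Finset.mem_image.1 he
              exact update_mem_envReps i _
            have hle : ∀ e ∈ envReps m i,
                (B e).indicator (1 : Payoffs m × Profile m → ℝ) ω ≤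
                  if e ∈ J then 0 else 1 := by
              intro e _
              by_cases he : e ∈ J
              · obtain ⟨l, hl, rfl⟩ := Finset.mem_image.1 he
                rw [if_pos he, Set.indicator_of_notMem]
                exact fun h => h.2 l (Nat.le_of_lt_succ (Finset.mem_range.1 hl))
                  (agreeOff_update _ _ _).symm
              · rw [if_neg he]
                exact Set.indicator_le_self' (fun _ _ => zero_le_one) ω
            refine (Finset.sum_le_sum hle).trans ?_
            rw [Set.indicator_of_mem hω, ← Finset.sum_sdiff hsub,
              Finset.sum_congr rfl fun e he => if_neg (Finset.mem_sdiff.1 he).2,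
              Finset.sum_congr (s₁ := J) rfl fun e he => if_pos he, Finset.sum_const,
              Finset.card_sdiff_of_subset hsub, hcard, ← card_envReps, Finset.sum_const_zero,
              nsmul_eq_mul, Nat.cast_sub (hcard ▸ Finset.card_le_card hsub)]
            simp
          · rw [Set.indicator_of_notMem hω, mul_zero]
            exact (Finset.sum_eq_zero fun e _ =>
              Set.indicator_of_notMem (fun h => hω h.1) _).le
      _ = _ := by
          rw [integral_const_mul, integral_indicator_one hF]
  refine h1.trans ?_
  rw [← Finset.sum_div, div_le_iff₀ hq]
  refine h2.trans (le_of_eq ?_)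
  field_simp

theorem measure_fresh_le (i : Fin n) (k : ℕ) :
    (randomGame m P).real (fresh m (i + k * n + 1)) ≤
      Real.exp (-(k * (k + 1)) / (2 * numEnv m i)) := by
  induction k with
  | zero => simp
  | succ k ih =>
    have hq := numEnv_pos (m := m) i
    calc _ ≤ (1 - (k + 1) / numEnv m i) *
          (randomGame m P).real (fresh m (i + k * n + 1)) := measure_fresh_succ_le P i k
      _ ≤ Real.exp (-((k + 1) / numEnv m i)) *
          Real.exp (-(k * (k + 1)) / (2 * numEnv m i)) := by
          refine mul_le_mul ?_ ih measureReal_nonneg (Real.exp_pos _).le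
          have := Real.add_one_le_exp (-((k + 1) / numEnv m i))
          linarith
      _ = _ := by
          rw [← Real.exp_add]
          congr 1
          push_cast
          field_simp
          ring

theorem convergenceProb_le (i : Fin n) (hi : ∀ j, numEnv m i ≤ numEnv m j) (k : ℕ) :
    convergenceProb m P ≤
      Real.exp (-(k * (k + 1)) / (2 * numEnv m i)) + k * n / numEnv m i := by
  have hq := numEnv_pos (m := m) i
  let A : ℕ → Set (Payoffs m × Profile m) := fun r =>
    fresh m (n + r) ∩ {ω | AgreeOff (mover n (n + r)) (path (n + r) ω) (path r ω)}
  calc convergenceProb m P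
      ≤ (randomGame m P).real (fresh m ((k + 1) * n) ∪ ⋃ r ∈ Finset.range (k * n), A r) := by
        refine ENNReal.toReal_mono (measure_ne_top _ _) (measure_mono_ae ?_)
        filter_upwards [ae_randomGame_noTies P] with ω hω hc
        rcases exists_first_repetition_of_converges hω hc ((k + 1) * n) with h | ⟨r, h1, h2, h3⟩
        · exact Or.inl h
        · refine Or.inr ?_
          obtain ⟨s, rfl⟩ := Nat.exists_eq_add_of_le h1
          rw [Nat.add_sub_cancel_left] at h3
          refine Set.mem_biUnion (x := s) ?_ h3
          simp only [Finset.coe_range, Set.mem_Iio]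
          rw [Nat.add_mul] at h2
          lia
    _ ≤ (randomGame m P).real (fresh m ((k + 1) * n)) +
        ∑ r ∈ Finset.range (k * n), (randomGame m P).real (A r) :=
        (measureReal_union_le _ _).trans (by gcongr; exact measureReal_biUnion_finset_le _ _)
    _ ≤ _ := by
        refine add_le_add ?_ ?_
        · refine le_trans (measureReal_mono (fresh_anti ?_)) (measure_fresh_le P i k)
          rw [Nat.add_mul]
          have := i.isLt
          lia
        · calc ∑ r ∈ Finset.range (k * n), (randomGame m P).real (A r)
              ≤ ∑ r ∈ Finset.range (k * n), 1 / numEnv m i := by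
                refine Finset.sum_le_sum fun r _ => ?_
                refine (measure_fresh_agreeOff_le P (by lia) _).trans ?_
                exact one_div_le_one_div_of_le hq (hi _)
            _ = _ := by simp [div_eq_mul_inv]

end ClockworkBR

/-! ### The lower bound: disjoint ways to come to rest. -/

namespace ClockworkBR

variable {n : ℕ} {m : Fin n → ℕ}

section Deterministic

variable [NeZero n]

/-- The path is fresh up to time `t`, and its value at time `t` does not return to an environment
in which the moving player acted more than one round ago. -/
def spread (m : Fin n → ℕ) (t : ℕ) : Set (Payoffs m × Profile m) :=
  fresh m t ∩ {ω | ∀ s, s + n < t → ¬ AgreeOff (mover n s) (path s ω) (path t ω)}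

/-- The path is constant from time `t` to time `t + d`. -/
def still (m : Fin n → ℕ) (t d : ℕ) : Set (Payoffs m × Profile m) :=
  {ω | ∀ k ≤ d, path (t + k) ω = path t ω}

theorem isPast_spread (t : ℕ) : IsPast t (spread m t) := by
  refine (isPast_fresh t).inter ?_
  intro ω ω' h hω s hs
  rw [← h s (by lia), ← h t le_rfl]
  exact hω s hs

theorem isPast_still (t d : ℕ) : IsPast (t + d) (still m t d) := by
  intro ω ω' h hω k hk
  rw [← h (t + k) (by lia), ← h t (by lia)]
  exact hω k hk

theorem still_succ (t d : ℕ) :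
    still m t (d + 1) = still m t d ∩ {ω | path (t + d + 1) ω = path (t + d) ω} := by
  ext ω
  constructor
  · intro h
    refine ⟨fun k hk => h k (by lia), ?_⟩
    exact (h (d + 1) le_rfl).trans (h d (by lia)).symm
  · rintro ⟨h1, h2⟩ k hk
    rcases hk.eq_or_lt with rfl | hlt
    · exact Eq.trans h2 (h1 d le_rfl)
    · exact h1 k (by lia)

/-- `spread` rules out all old visits except the player's own previous move. If the environment is
unchanged since that move, she repeats the action she still holds. -/
theorem newEnv_or_stay {t d : ℕ} (hd : d + 1 < n) {ω : Payoffs m × Profile m}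
    (h1 : ω ∈ spread m t) (h2 : ω ∈ still m t d) :
    NewEnv (t + d) ω ∨ path (t + d + 1) ω = path (t + d) ω := by
  refine or_iff_not_imp_left.2 fun hnew => ?_
  obtain ⟨s, hs, hm, hag⟩ : ∃ s < t + d, mover n s = mover n (t + d) ∧
      AgreeOff (mover n (t + d)) (path s ω) (path (t + d) ω) := by
    simpa [NewEnv] using hnew
  have hst : ¬ s + n < t := fun hlt => by
    refine h1.2 s hlt ?_
    rw [hm, ← h2 d le_rfl]
    exact hag
  have hle := add_le_of_mover_eq hs hm
  have hsn : s + n = t + d := by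
    refine hle.eq_or_lt.resolve_right fun hlt => hst ?_
    have := add_le_of_mover_eq hlt ((mover_add_self s).trans hm)
    lia
  refine (agreeOff_path_succ (t + d) ω).eq_of_apply_eq ?_
  rw [← hag.path_succ_eq hm]
  have hw := path_add_apply_of_forall_ne (t := s + 1) (d := n - 1) (j := mover n (t + d))
    (fun k hk heq => ?_) ω
  · exact hw.symm.trans (by rw [show s + 1 + (n - 1) = t + d by lia])
  · have := injOn_mover_add (n := n) s (by simp; lia : 0 ∈ _) (by simp; lia : 1 + k ∈ _)
      (by simpa [Nat.add_assoc, hm] using heq)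
    lia

/-- Player `i` has just best-responded, and the other `n - 1` players move in turn without changing
anything. Ties do no harm here. -/
theorem mem_PNE_of_still {i : Fin n} {l : ℕ} {ω : Payoffs m × Profile m}
    (h : ω ∈ still m (i + l * n + 1) (n - 1)) : path (i + l * n + 1) ω ∈ PNE ω.1 := by
  refine mem_PNE_of_forall_bestResponse_eq fun j => ?_
  obtain ⟨k, hk, rfl⟩ := exists_mover_eq (n := n) (i + l * n) j
  cases k with
  | zero =>
    exact ((agreeOff_path_succ (i + l * n) ω).bestResponse_eq ω.1).trans
      (path_succ_apply_mover (i + l * n) ω).symm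
  | succ k =>
    have h1 := h k (by lia)
    have h2 := h (k + 1) (by lia)
    have h3 := path_succ_apply_mover (i + l * n + 1 + k) ω
    rw [← Nat.add_assoc] at h2
    rw [h1, h2] at h3
    rw [show (i : ℕ) + l * n + (k + 1) = i + l * n + 1 + k by ring]
    exact h3.symm

/-- Standing still for the rest of the round brings `i` back to her previous environment, which ends
freshness. -/
theorem disjoint_spread_still (i : Fin n) {l l' : ℕ} (hl : l < l') :
    Disjoint (still m (i + l * n + 1) (n - 1)) (spread m (i + l' * n + 1)) := by
  refine Set.disjoint_left.2 fun ω h1 h2 => ?_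
  have hn := Nat.pos_of_ne_zero (NeZero.ne n)
  have hle : (l + 1) * n ≤ l' * n := Nat.mul_le_mul_right n hl
  have hmul : (l + 1) * n = l * n + n := by ring
  have hc := h1 (n - 1) le_rfl
  rw [show (i : ℕ) + l * n + 1 + (n - 1) = i + (l + 1) * n by lia] at hc
  refine h2.1 (i + (l + 1) * n) (by lia) (i + l * n) (by lia) ?_ ?_
  · rw [mover_val_add_mul, mover_val_add_mul]
  · rw [hc, mover_val_add_mul]
    have := agreeOff_path_succ (i + l * n) ω
    rw [mover_val_add_mul] at this
    exact this.symm

theorem prod_mover_eq_numEnv (i : Fin n) (l : ℕ) (hi : m i ≠ 0) :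
    ∏ d ∈ Finset.range (n - 1), (m (mover n (i + l * n + 1 + d)) : ℝ) = numEnv m i := by
  have h := prod_mover (n := n) (fun k => (m k : ℝ)) (i + l * n)
  have hrange : Finset.range n = Finset.range (n - 1 + 1) := by
    rw [Nat.sub_add_cancel (Nat.pos_of_ne_zero (NeZero.ne n))]
  rw [hrange, Finset.prod_range_succ', ← Finset.prod_erase_mul _ _ (Finset.mem_univ i)] at h
  rw [Nat.add_zero, mover_val_add_mul] at h
  refine Eq.trans (Finset.prod_congr rfl fun d _ => ?_)
    (mul_right_cancel₀ (Nat.cast_ne_zero.2 hi) h)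
  rw [Nat.add_assoc _ 1 d, Nat.add_comm 1 d]

end Deterministic

variable [∀ i, NeZero (m i)] (P : Measure ℝ) [IsProbabilityMeasure P]
variable [NeZero n] [NullSingletonClass P]

/-- In a new environment the current action is chosen with probability exactly `1 / m`; otherwise
staying is certain. -/
theorem measure_stay_ge {t : ℕ} {B : Set (Payoffs m × Profile m)} (hB : IsPast t B)
    (h : ∀ ω ∈ B, NewEnv t ω ∨ path (t + 1) ω = path t ω) :
    (randomGame m P).real B / m (mover n t) ≤
      (randomGame m P).real (B ∩ {ω | path (t + 1) ω = path t ω}) := by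
  have hm : (1 : ℝ) ≤ m (mover n t) :=
    Nat.one_le_cast.2 (Nat.pos_of_ne_zero (NeZero.ne _))
  have hN := (isPast_newEnv (m := m) t).measurableSet
  rw [← measureReal_inter_add_sdiff (s := B) hN, ←
    measureReal_inter_add_sdiff (s := B ∩ {ω | path (t + 1) ω = path t ω}) hN, add_div]
  refine add_le_add ?_ ?_
  · rw [← measure_new_move P (hB.inter (isPast_newEnv t)) (fun ω hω => hω.2)
      fun e => e (mover n t)]
    exact measureReal_mono fun ω hω =>
      ⟨⟨hω.1.1, (agreeOff_path_succ t ω).eq_of_apply_eq hω.2⟩, hω.1.2⟩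
  · refine (div_le_self measureReal_nonneg hm).trans (measureReal_mono fun ω hω => ?_)
    exact ⟨⟨hω.1, (h ω hω.1).resolve_left hω.2⟩, hω.2⟩

theorem measure_spread_still_ge (t : ℕ) {d : ℕ} (hd : d < n) :
    (randomGame m P).real (spread m t) / ∏ k ∈ Finset.range d, (m (mover n (t + k)) : ℝ) ≤
      (randomGame m P).real (spread m t ∩ still m t d) := by
  induction d with
  | zero =>
    simp only [Finset.range_zero, Finset.prod_empty, div_one]
    refine measureReal_mono fun ω hω => ⟨hω, fun k hk => ?_⟩
    rw [Nat.le_zero.1 hk, Nat.add_zero]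
  | succ d ih =>
    have h := measure_stay_ge P (((isPast_spread (m := m) t).mono (Nat.le_add_right t d)).inter
      (isPast_still t d)) fun ω hω => newEnv_or_stay hd hω.1 hω.2
    rw [Finset.prod_range_succ, ← div_div, still_succ, ← Set.inter_assoc]
    exact (div_le_div_of_nonneg_right (ih (by lia)) (Nat.cast_nonneg _)).trans h

/-- Union bound over the `t / n` earlier moves of the same player. -/
theorem measure_fresh_succ_ge {q : ℝ} (hq : 0 < q) (hle : ∀ j, q ≤ numEnv m j) (t : ℕ) :
    (randomGame m P).real (fresh m t) - (t / n : ℕ) / q ≤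
      (randomGame m P).real (fresh m (t + 1)) := by
  have hn := Nat.pos_of_ne_zero (NeZero.ne n)
  have hN := (isPast_newEnv (m := m) t).measurableSet
  rw [fresh_succ, ← measureReal_inter_add_sdiff (s := fresh m t) hN, sub_le_iff_le_add]
  gcongr
  let s : ℕ → ℕ := fun c => t % n + n * c
  have hs : ∀ c < t / n, s c + n ≤ t := fun c hc => by
    have h1 := Nat.mod_add_div t n
    have h2 : n * (c + 1) ≤ n * (t / n) := Nat.mul_le_mul_left n hc
    rw [Nat.mul_add, Nat.mul_one] at h2
    simp only [s]
    lia
  calc (randomGame m P).real (fresh m t \ {ω | NewEnv t ω})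
      ≤ (randomGame m P).real (⋃ c ∈ Finset.range (t / n),
          (fresh m t ∩ {ω | AgreeOff (mover n t) (path t ω) (path (s c) ω)})) := by
        refine measureReal_mono (fun ω hω => ?_) (measure_ne_top _ _)
        obtain ⟨r, hr, hm, hag⟩ : ∃ s < t, mover n s = mover n t ∧
            AgreeOff (mover n t) (path s ω) (path t ω) := by
          simpa [NewEnv] using hω.2
        have hrs : s (r / n) = r := by
          simp only [s]
          rw [← mover_eq_iff.1 hm, Nat.mod_add_div]
        refine Set.mem_biUnion (x := r / n) ?_ ⟨hω.1, by rw [hrs]; exact hag.symm⟩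
        simp only [Finset.coe_range, Set.mem_Iio]
        have := Nat.div_le_div_right (c := n) (add_le_of_mover_eq hr hm)
        rw [Nat.add_div_right r hn] at this
        lia
    _ ≤ ∑ c ∈ Finset.range (t / n), (randomGame m P).real
          (fresh m t ∩ {ω | AgreeOff (mover n t) (path t ω) (path (s c) ω)}) :=
        measureReal_biUnion_finset_le _ _
    _ ≤ ∑ c ∈ Finset.range (t / n), 1 / q := by
        refine Finset.sum_le_sum fun c hc => ?_
        exact (measure_fresh_agreeOff_le P (hs c (Finset.mem_range.1 hc)) _).trans
          (one_div_le_one_div_of_le hq (hle _))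
    _ = _ := by simp [div_eq_mul_inv]

theorem measure_fresh_mul_ge {q : ℝ} (hq : 0 < q) (hle : ∀ j, q ≤ numEnv m j) (k : ℕ) :
    1 - n * (k * (k - 1)) / (2 * q) ≤ (randomGame m P).real (fresh m (k * n)) := by
  induction k with
  | zero => simp [fresh]
  | succ k ih =>
    have hround : ∀ d ≤ n, (randomGame m P).real (fresh m (k * n)) - d * (k / q) ≤
        (randomGame m P).real (fresh m (k * n + d)) := by
      intro d
      induction d with
      | zero => simp
      | succ d ihd =>
        intro hd
        have h := measure_fresh_succ_ge P hq hle (k * n + d)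
        have hdiv : (k * n + d) / n = k := by
          rw [Nat.add_comm, Nat.add_mul_div_right _ _ (by lia), Nat.div_eq_of_lt (by lia)]
          simp
        rw [hdiv] at h
        have := ihd (by lia)
        rw [← Nat.add_assoc]
        push_cast
        linarith
    have h := hround n le_rfl
    rw [Nat.succ_mul]
    refine le_trans ?_ h
    push_cast
    have : (1 - n * ((k + 1) * (k + 1 - 1)) / (2 * q) : ℝ) =
        1 - n * (k * (k - 1)) / (2 * q) - n * (k / q) := by
      field_simp
      ring
    linarith

theorem measure_spread_ge {q : ℝ} (hq : 0 < q) (hle : ∀ j, q ≤ numEnv m j) (i : Fin n) (l : ℕ) :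
    1 - n * (l * (l + 3)) / (2 * q) ≤
      (randomGame m P).real (spread m (i + l * n + 1)) := by
  have hfresh : 1 - n * ((l + 1) * l) / (2 * q) ≤
      (randomGame m P).real (fresh m (i + l * n + 1)) := by
    refine le_trans ?_ ((measure_fresh_mul_ge P hq hle (l + 1)).trans
      (measureReal_mono (fresh_anti ?_)))
    · push_cast
      simp
    · have := i.isLt
      rw [Nat.succ_mul]
      lia
  -- Since `i < n`, the excluded times `s` all lie below `l * n`, and each is hit with probability
  -- at most `1 / q`.
  have hdiff : (randomGame m P).real (fresh m (i + l * n + 1)) -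
      (randomGame m P).real (spread m (i + l * n + 1)) ≤ l * n / q := by
    calc (randomGame m P).real (fresh m (i + l * n + 1)) -
          (randomGame m P).real (spread m (i + l * n + 1))
        ≤ (randomGame m P).real (⋃ s ∈ Finset.range (l * n), (fresh m (i + l * n + 1) ∩
          {ω | s + n < i + l * n + 1 ∧
            AgreeOff (mover n s) (path (i + l * n + 1) ω) (path s ω)})) := by
          rw [sub_le_iff_le_add']
          refine (measureReal_mono (fun ω hω => ?_) (measure_ne_top _ _)).trans
            (measureReal_union_le _ _)
          by_cases hsp : ω ∈ spread m (i + l * n + 1)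
          · exact Or.inl hsp
          · refine Or.inr ?_
            obtain ⟨s, hs, hag⟩ : ∃ s, s + n < i + l * n + 1 ∧
                AgreeOff (mover n s) (path s ω) (path (i + l * n + 1) ω) := by
              simpa [spread, hω] using hsp
            refine Set.mem_biUnion (x := s) ?_ ⟨hω, hs, hag.symm⟩
            have := i.isLt
            simp only [Finset.coe_range, Set.mem_Iio]
            lia
      _ ≤ ∑ s ∈ Finset.range (l * n), (randomGame m P).real (fresh m (i + l * n + 1) ∩
          {ω | s + n < i + l * n + 1 ∧
            AgreeOff (mover n s) (path (i + l * n + 1) ω) (path s ω)}) :=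
          measureReal_biUnion_finset_le _ _
      _ ≤ ∑ s ∈ Finset.range (l * n), 1 / q := by
          refine Finset.sum_le_sum fun s _ => ?_
          by_cases hs : s + n < i + l * n + 1
          · simp only [hs, true_and]
            exact (measure_fresh_agreeOff_le P hs.le _).trans
              (one_div_le_one_div_of_le hq (hle _))
          · simp [hs, hq.le]
      _ = _ := by simp [div_eq_mul_inv]
  have : (1 - n * (l * (l + 3)) / (2 * q) : ℝ) =
      1 - n * ((l + 1) * l) / (2 * q) - l * n / q := by
    field_simp
    ring
  linarith

/-- The events of coming to rest right after the move of `i` in round `l` are disjoint, so their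
probabilities add; no second-moment argument is needed. -/
theorem convergenceProb_ge (i : Fin n) (hi : ∀ j, numEnv m i ≤ numEnv m j) (K : ℕ) :
    ∑ l ∈ Finset.range K, (1 - n * (l * (l + 3)) / (2 * numEnv m i)) / numEnv m i ≤
      convergenceProb m P := by
  have hq := numEnv_pos (m := m) i
  have hn := Nat.pos_of_ne_zero (NeZero.ne n)
  let A : ℕ → Set (Payoffs m × Profile m) := fun l =>
    spread m (i + l * n + 1) ∩ still m (i + l * n + 1) (n - 1)
  have hdisj : (Finset.range K : Set ℕ).PairwiseDisjoint A := by
    intro a _ b _ hab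
    rcases lt_or_gt_of_ne hab with h | h
    · exact (disjoint_spread_still i h).mono Set.inter_subset_right Set.inter_subset_left
    · exact ((disjoint_spread_still i h).mono Set.inter_subset_right Set.inter_subset_left).symm
  calc ∑ l ∈ Finset.range K, (1 - n * (l * (l + 3)) / (2 * numEnv m i)) / numEnv m i
      ≤ ∑ l ∈ Finset.range K, (randomGame m P).real (A l) := by
        refine Finset.sum_le_sum fun l _ => ?_
        have h := measure_spread_still_ge (m := m) P (i + l * n + 1) (d := n - 1) (by lia)
        rw [prod_mover_eq_numEnv i l (NeZero.ne _)] at h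
        exact (div_le_div_of_nonneg_right (measure_spread_ge P hq hi i l) hq.le).trans h
    _ = (randomGame m P).real (⋃ l ∈ Finset.range K, A l) := by
        refine (measureReal_biUnion_finset hdisj fun l _ => ?_).symm
        exact (((isPast_spread _).mono (Nat.le_add_right _ _)).inter
          (isPast_still _ _)).measurableSet
    _ ≤ convergenceProb m P := by
        refine measureReal_mono (fun ω hω => ?_) (measure_ne_top _ _)
        simp only [Set.mem_iUnion] at hω
        obtain ⟨l, -, hl⟩ := hω
        exact ⟨i + l * n + 1, by lia, mem_PNE_of_still hl.2⟩

end ClockworkBR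

/-! ### Numerical estimates and the choice of horizons. -/

namespace ClockworkBR

variable {n : ℕ} {m : Fin n → ℕ}

theorem exists_minEnv_eq [NeZero n] [∀ i, NeZero (m i)] :
    ∃ i, minEnv m = numEnv m i ∧ ∀ j, numEnv m i ≤ numEnv m j := by
  obtain ⟨i, -, hi⟩ := Finset.exists_mem_eq_sup Finset.univ Finset.univ_nonempty m
  have hpos : ∀ j, (0 : ℝ) < m j := fun j => Nat.cast_pos.2 (Nat.pos_of_ne_zero (NeZero.ne _))
  have hnum : ∀ j, numEnv m j = (∏ k, (m k : ℝ)) / m j := fun j => by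
    rw [eq_div_iff (hpos j).ne', numEnv, Finset.prod_erase_mul _ _ (Finset.mem_univ j)]
  refine ⟨i, by rw [minEnv, hi, hnum], fun j => ?_⟩
  rw [hnum, hnum]
  have hle : m j ≤ m i := hi ▸ Finset.le_sup (Finset.mem_univ j)
  exact div_le_div_of_nonneg_left (Finset.prod_nonneg fun k _ => (hpos k).le) (hpos j)
    (Nat.cast_le.2 hle)

theorem two_pow_le_numEnv (hm : ∀ i, 2 ≤ m i) (i : Fin n) : (2 : ℝ) ^ (n - 1) ≤ numEnv m i := by
  have h := Finset.prod_le_prod (s := Finset.univ.erase i) (f := fun _ => (2 : ℝ))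
    (g := fun k => (m k : ℝ)) (fun _ _ => zero_le_two) fun k _ => by exact_mod_cast hm k
  simpa [Finset.card_erase_of_mem, numEnv] using h

theorem nat_le_two_pow_pred (n : ℕ) (hn : 1 ≤ n) : n ≤ 2 ^ (n - 1) := by
  have := Nat.lt_two_pow_self (n := n - 1)
  lia

theorem nat_le_one_add_two_mul_log {q : ℝ} (hn : 1 ≤ n) (hq : (2 : ℝ) ^ (n - 1) ≤ q) :
    (n : ℝ) ≤ 1 + 2 * Real.log q := by
  have h := Real.log_le_log (by positivity) hq
  rw [Real.log_pow, Nat.cast_sub hn] at h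
  have h2 := Real.log_two_gt_d9
  have h1 : (1 : ℝ) ≤ n := by exact_mod_cast hn
  push_cast at h
  nlinarith

theorem sum_lower_terms_ge {q : ℝ} (hq : 0 < q) (hn : 1 ≤ n) (hnq : (n : ℝ) ≤ q) :
    ∃ K : ℕ, 1 / (4 * √(n : ℝ)) * (1 / √q) ≤
      ∑ l ∈ Finset.range K, (1 - n * (l * (l + 3)) / (2 * q)) / q := by
  have hn0 : (0 : ℝ) < n := by exact_mod_cast hn
  have hcube : ∀ K : ℕ, (K - n * K ^ 3 / (2 * q)) / q ≤
      ∑ l ∈ Finset.range K, (1 - n * (l * (l + 3)) / (2 * q)) / q := by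
    intro K
    induction K with
    | zero => simp
    | succ K ih =>
      rw [Finset.sum_range_succ]
      refine le_trans ?_ (add_le_add_left ih _)
      rw [← add_div]
      refine div_le_div_of_nonneg_right ?_ hq.le
      -- The cubic telescopes, because `K(K+3) ≤ (K+1)^3 - K^3`.
      have h : (n * (K * (K + 3)) / (2 * q) : ℝ) ≤
          n * (K + 1) ^ 3 / (2 * q) - n * K ^ 3 / (2 * q) := by
        rw [← sub_div, ← mul_sub]
        have hK : (0 : ℝ) ≤ K := Nat.cast_nonneg K
        gcongr
        nlinarith
      push_cast
      linarith
  set y := √(q / n) with hy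
  have hy1 : 1 ≤ y := Real.one_le_sqrt.2 ((one_le_div hn0).2 hnq)
  have hysq : y ^ 2 = q / n := Real.sq_sqrt (by positivity)
  have hqy : q = n * y ^ 2 := by rw [hysq]; field_simp
  -- With `K ≤ √(q/n)` the cubic loss is at most `K/2`, and `y ≥ 1` gives `K ≥ y/2`; together these
  -- produce the factor `1/4`.
  refine ⟨⌊y⌋₊, le_trans ?_ (hcube _)⟩
  have hK1 : (1 : ℝ) ≤ (⌊y⌋₊ : ℝ) := by exact_mod_cast (Nat.one_le_floor_iff y).2 hy1
  have hKle : (⌊y⌋₊ : ℝ) ≤ y := Nat.floor_le (by linarith)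
  have hKlt : y < ⌊y⌋₊ + 1 := Nat.lt_floor_add_one y
  set K : ℝ := (⌊y⌋₊ : ℝ)
  have hsqrt : √(n : ℝ) * √q = n * y := by
    rw [← Real.sqrt_mul hn0.le, hqy, show (n : ℝ) * (n * y ^ 2) = (n * y) ^ 2 by ring,
      Real.sqrt_sq (by positivity)]
  have hlhs : 1 / (4 * √(n : ℝ)) * (1 / √q) = 1 / (4 * (n * y)) := by
    rw [← hsqrt]
    field_simp
  have hcub : n * K ^ 3 / (2 * q) ≤ K / 2 := by
    rw [hqy, div_le_div_iff₀ (by positivity) two_pos]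
    have : K ^ 2 ≤ y ^ 2 := pow_le_pow_left₀ (by linarith) hKle 2
    nlinarith [mul_le_mul_of_nonneg_left this (by positivity : 0 ≤ n * K)]
  rw [hlhs]
  calc 1 / (4 * (n * y)) = (y / 4) / q := by rw [hqy]; field_simp
    _ ≤ _ := div_le_div_of_nonneg_right (by linarith) hq.le

theorem upper_terms_le {q : ℝ} (hq : 2 ≤ q) (hn : 2 ≤ n) :
    ∃ k : ℕ, Real.exp (-(k * (k + 1)) / (2 * q)) + k * n / q ≤
      6 * n * √(Real.log q) * (1 / √q) := by
  have hq0 : 0 < q := by linarith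
  have hn2 : (2 : ℝ) ≤ n := by exact_mod_cast hn
  have hlog : 1 / 4 ≤ Real.log q := by
    have := Real.log_le_log two_pos hq
    linarith [Real.log_two_gt_d9]
  set L := √(Real.log q) with hL
  set s := √q with hs
  have hLsq : L ^ 2 = Real.log q := Real.sq_sqrt (by linarith)
  have hssq : s ^ 2 = q := Real.sq_sqrt hq0.le
  have hL2 : 1 / 2 ≤ L := Real.le_sqrt_of_sq_le (by linarith)
  have hs1 : 1 ≤ s := Real.one_le_sqrt.2 (by linarith)
  have hk1 : s * L ≤ (⌈s * L⌉₊ : ℝ) := Nat.le_ceil _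
  have hk2 : (⌈s * L⌉₊ : ℝ) < s * L + 1 := Nat.ceil_lt_add_one (by positivity)
  -- At `k ≥ √(q log q)` the exponential falls to `1/√q`, and the linear term is about `n √(log q /
  -- q)`.
  refine ⟨⌈s * L⌉₊, ?_⟩
  set k : ℝ := (⌈s * L⌉₊ : ℝ)
  have hexp : Real.exp (-(k * (k + 1)) / (2 * q)) ≤ 1 / s := by
    have h1 : 1 / s = Real.exp (-(Real.log q / 2)) := by
      rw [Real.exp_neg, one_div, hs, Real.sqrt_eq_rpow, Real.rpow_def_of_pos hq0]
      ring_nf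
    rw [h1, Real.exp_le_exp, neg_div, neg_le_neg_iff, div_le_div_iff₀ two_pos (by positivity)]
    have h2 : (s * L) ^ 2 ≤ k ^ 2 := pow_le_pow_left₀ (by positivity) hk1 2
    rw [mul_pow, hssq, hLsq] at h2
    have h3 : 0 ≤ k := by positivity
    nlinarith
  have hlin : k * n / q ≤ (s * L + 1) * n / q := by gcongr
  have hsplit : (s * L + 1) * n / q = n * L * (1 / s) + n / s * (1 / s) := by
    rw [← hssq]
    field_simp
  have hns : n / s ≤ n := div_le_self (by positivity) hs1
  -- The constant 6 absorbs the rounding and the exponential term, using `L ≥ 1/2` and `n ≥ 2`.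
  have hfin : (1 : ℝ) + n * L + n / s ≤ 6 * n * L := by nlinarith
  have := mul_le_mul_of_nonneg_right hfin (by positivity : 0 ≤ 1 / s)
  linarith

theorem exists_forall_log_sq_le_rpow {ε : ℝ} (hε : 0 < ε) :
    ∃ Q : ℝ, ∀ q, Q ≤ q → 1 ≤ Real.log q ∧ 18 * Real.log q ^ 2 ≤ q ^ ε := by
  have h1 := (isLittleO_log_rpow_rpow_atTop 2 hε).bound (show (0 : ℝ) < 1 / 18 by norm_num)
  have h2 := Real.tendsto_log_atTop.eventually_ge_atTop 1
  obtain ⟨Q, hQ⟩ := Filter.eventually_atTop.1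
    ((h1.and h2).and (Filter.eventually_ge_atTop (0 : ℝ)))
  refine ⟨Q, fun q hq => ?_⟩
  obtain ⟨⟨h3, h4⟩, h5⟩ := hQ q hq
  refine ⟨h4, ?_⟩
  rw [Real.rpow_two, Real.norm_of_nonneg (by positivity),
    Real.norm_of_nonneg (Real.rpow_nonneg h5 _)] at h3
  linarith

theorem convergenceProb_bounds [NeZero n] (P : Measure ℝ) [IsProbabilityMeasure P]
    [NullSingletonClass P] (hn : 2 ≤ n) (hm : ∀ i, 2 ≤ m i) :
    1 / (4 * √(n : ℝ)) * (1 / √(minEnv m)) ≤ convergenceProb m P ∧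
      convergenceProb m P ≤ 6 * (n : ℝ) * √(Real.log (minEnv m)) * (1 / √(minEnv m)) := by
  have hne : ∀ i, NeZero (m i) := fun i => ⟨by have := hm i; lia⟩
  obtain ⟨i, hi, hmin⟩ := exists_minEnv_eq (m := m)
  have hpow := two_pow_le_numEnv hm i
  have hnq : (n : ℝ) ≤ numEnv m i :=
    le_trans (by exact_mod_cast nat_le_two_pow_pred n (by lia)) hpow
  have hq2 : 2 ≤ numEnv m i := le_trans (by exact_mod_cast hn) hnq
  rw [hi]
  constructor
  · obtain ⟨K, hK⟩ := sum_lower_terms_ge (n := n) (by linarith) (by lia) hnq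
    exact hK.trans (convergenceProb_ge P i hmin K)
  · obtain ⟨k, hk⟩ := upper_terms_le hq2 hn
    exact (convergenceProb_le P i hmin k).trans hk

end ClockworkBR

/-! ### The explicit bounds and the uniform exponent. -/

theorem corollary1 :
    (∀ (n : ℕ) [NeZero n] (m : Fin n → ℕ) (P : Measure ℝ) [IsProbabilityMeasure P] [NullSingletonClass P],
      2 ≤ n → (∀ i, 2 ≤ m i) →
        1 / (4 * √(n : ℝ)) * (1 / √(ClockworkBR.minEnv m)) ≤ ClockworkBR.convergenceProb m P ∧
        ClockworkBR.convergenceProb m P ≤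
          6 * (n : ℝ) * √(Real.log (ClockworkBR.minEnv m)) * (1 / √(ClockworkBR.minEnv m))) ∧
    (∀ ε : ℝ, 0 < ε → ∃ Q : ℝ,
      ∀ (n : ℕ) [NeZero n] (m : Fin n → ℕ) (P : Measure ℝ) [IsProbabilityMeasure P] [NullSingletonClass P],
        2 ≤ n → (∀ i, 2 ≤ m i) → Q ≤ ClockworkBR.minEnv m →
          ClockworkBR.minEnv m ^ (-(1 / 2 : ℝ) - ε) ≤ ClockworkBR.convergenceProb m P ∧
          ClockworkBR.convergenceProb m P ≤ ClockworkBR.minEnv m ^ (-(1 / 2 : ℝ) + ε)) := by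
  refine ⟨fun n _ m P _ _ hn hm => ClockworkBR.convergenceProb_bounds P hn hm, fun ε hε => ?_⟩
  obtain ⟨Q, hQ⟩ := ClockworkBR.exists_forall_log_sq_le_rpow hε
  refine ⟨Q, fun n _ m P _ _ hn hm hq => ?_⟩
  obtain ⟨hlow, hup⟩ := ClockworkBR.convergenceProb_bounds P hn hm
  obtain ⟨hlog, hsq⟩ := hQ _ hq
  have hne : ∀ i, NeZero (m i) := fun i => ⟨by have := hm i; lia⟩
  obtain ⟨i, hi, -⟩ := ClockworkBR.exists_minEnv_eq (m := m)
  have hpow := ClockworkBR.two_pow_le_numEnv hm i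
  rw [← hi] at hpow
  have hnlog := ClockworkBR.nat_le_one_add_two_mul_log (n := n) (by lia) hpow
  set q := ClockworkBR.minEnv m
  have hq0 : 0 < q := lt_of_lt_of_le (by positivity) hpow
  have hn2 : (2 : ℝ) ≤ n := by exact_mod_cast hn
  have hhalf : q ^ (-(1 / 2) : ℝ) = 1 / √q := by
    rw [Real.rpow_neg hq0.le, Real.sqrt_eq_rpow, one_div (q ^ _)]
  have hsqrt_log : √(Real.log q) ≤ Real.log q :=
    Real.sqrt_le_left (by linarith) |>.2 (by nlinarith)
  -- As `q ≥ 2^(n-1)`, the number of players is at most `3 log q`, so the polynomial factor is at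
  -- most `18 (log q)^2`, uniformly in the game.
  have hpoly : 6 * n * √(Real.log q) ≤ q ^ ε := by
    refine le_trans ?_ hsq
    have : 6 * (n : ℝ) * √(Real.log q) ≤ 6 * (3 * Real.log q) * Real.log q := by
      gcongr
      linarith
    linarith
  have hsqrt_n : 4 * √(n : ℝ) ≤ q ^ ε := by
    refine le_trans ?_ hpoly
    have h1 : √(n : ℝ) ≤ n := Real.sqrt_le_left (by linarith) |>.2 (by nlinarith)
    have h2 : 1 ≤ √(Real.log q) := Real.one_le_sqrt.2 hlog
    nlinarith
  constructor
  · refine le_trans ?_ hlow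
    rw [Real.rpow_sub hq0, hhalf, div_eq_mul_inv, mul_comm, one_div (4 * _)]
    gcongr
  · refine hup.trans ?_
    rw [Real.rpow_add hq0, hhalf, mul_comm (1 / √q)]
    gcongr
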